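/- Let $\wp(u)=\wp(u;g_2,g_3)$ be the Weierstrass function of a period lattice $\mathcal L\subset\mathbb C$, and suppose that $g_2=0$ and $g_3\neq0$ (the equianharmonic case). Let $\ell,B\in\mathbb C$ with $\ell(\ell+1)\neq0$, and consider the Weierstrass-form Lamé equation $$\frac{d^2\psi}{du^2}-\left[\ell(\ell+1)\wp(u)+B\right]\psi=0. \tag{1}$$ For a nonconstant rational function $R\in\mathbb C(s)$, say that the substitution $z=R(\wp(u))$ *reduces* (1) to the hypergeometric equation with parameters $a,b,c\in\mathbb C$, $$\frac{d^2y}{dz^2}+\left(\frac cz+\frac{a+b-c+1}{z-1}\right)\frac{dy}{dz}+\frac{ab}{z(z-1)}\,y=0, \tag{2}$$ if substituting $z=\varphi(u):=R(\wp(u))$, $\psi(u)=y(\varphi(u))$ into (2) yields exactly (1), i.e. if $$\left(\frac c\varphi+\frac{a+b-c+1}{\varphi-1}\right)\varphi'-\frac{\varphi''}{\varphi'}=0,\qquad \frac{ab\,(\varphi')^2}{\varphi(\varphi-1)}=-\left[\ell(\ell+1)\wp+B\right]$$ at every $u\notin\mathcal L$ at which $R(\wp(u))$ is finite, $\varphi(u)\neq0,1$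 and $\varphi'(u)\neq0$. (i) There is a nonconstant rational function $R$ such that $z=R(\wp(u))$ reduces (1) to a hypergeometric equation (2), for some $a,b,c\in\mathbb C$, if and only if $B=0$. (ii) If $B=0$, the substitutions $z=R(\wp(u))$ with this property are exactly $$z=\frac{4\wp(u)^3}{g_3}\qquad\text{and}\qquad z=1-\frac{4\wp(u)^3}{g_3}.$$ (iii) This recovers the Clarkson–Olver transformation. If $B=0$, then $z=1-4\wp(u)^3/g_3$ reduces (1) to the hypergeometric equation with $(a,b;c)=\left(-\frac{\ell}{6},\frac{\ell+1}{6};\frac12\right)$. Moreover, $z=1-4\wp(u)^3/g_3$ inverts the Clarkson–Olver formula $u=\frac{\mathrm i}{(16g_3)^{1/6}}\int^{(1-z)^{1/3}}\frac{d\tau}{\sqrt{1-\tau^3}}$ in the following sense: for every choice of $\rho$ with $\rho^6=16g_3$ there is a holomorphic function $\tau$ on $\mathbb C\setminus\mathcal L$, with $\tau(u)\to\infty$ as $u\to0$, such that for all $u\in\mathbb C\setminus\mathcal L$ $$\tau(u)^3=1-z=\frac{4\wp(u)^3}{g_3},\qquad \left(\frac{\mathrm i}{\rho}\,\tau'(u)\right)^2=1-\tau(u)^3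 .$$ -/

import Mathlib

open scoped Topology

noncomputable section

/-- The homogeneous linear equation `y'' + p y' + q y = 0` in one complex variable, given by its
coefficient functions. -/
structure LinearODE where
  /-- the coefficient of the first derivative -/
  p : ℂ → ℂ
  /-- the coefficient of the unknown function -/
  q : ℂ → ℂ

/-- The Gauss hypergeometric equation
`y'' + (c / z + (a + b - c + 1) / (z - 1)) y' + (a b / (z (z - 1))) y = 0`. -/
def hypergeometricODE (a b c : ℂ) : LinearODE where
  p := fun z => c / z + (a + b - c + 1) / (z - 1)
  q := fun z => a * b / (z * (z - 1))

/-- The Weierstrass form of the Lamé equation, `ψ'' - (ℓ (ℓ + 1) ℘(u) + B) ψ = 0`, where `℘` is the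
Weierstrass function of the period lattice of `L`. -/
def lameODE (L : PeriodPair) (ℓ B : ℂ) : LinearODE where
  p := fun _ => 0
  q := fun u => -(ℓ * (ℓ + 1) * L.weierstrassP u + B)

/-- The equation in the variable `u` that the change of independent variable `z = φ(u)` makes out
of the equation `E` in the variable `z`: by the chain rule, `y''(z) + p(z) y'(z) + q(z) y(z) = 0`
becomes, for `ψ(u) = y(φ(u))`, the equation
`ψ'' + (p(φ) φ' - φ'' / φ') ψ' + q(φ) φ' ^ 2 ψ = 0`.
This is meaningful at the points where `φ` is holomorphic with `φ' ≠ 0` and takes a value at which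
the coefficients of `E` are defined. -/
def LinearODE.pullback (E : LinearODE) (φ : ℂ → ℂ) : LinearODE where
  p := fun u => E.p (φ u) * deriv φ u - deriv (deriv φ) u / deriv φ u
  q := fun u => E.q (φ u) * deriv φ u ^ 2

/-- The function `u ↦ R(℘(u))`. -/
def wpSubst (L : PeriodPair) (R : RatFunc ℂ) (u : ℂ) : ℂ :=
  R.eval (RingHom.id ℂ) (L.weierstrassP u)

/-- The points `u` where `z = R(℘(u))` is finite and holomorphic, has nonzero derivative, and is not
a singular point of the hypergeometric equation. For nonconstant `R` the other points form a
closed discrete set. -/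
def regularPoints (L : PeriodPair) (R : RatFunc ℂ) : Set ℂ :=
  {u | u ∉ L.lattice ∧ R.denom.eval (L.weierstrassP u) ≠ 0 ∧
    wpSubst L R u ≠ 0 ∧ wpSubst L R u ≠ 1 ∧ deriv (wpSubst L R) u ≠ 0}

/-- The substitution `z = R(℘(u))`, with `R` a nonconstant rational function, reduces the Lamé
equation with parameters `ℓ`, `B` to the hypergeometric equation with parameters `a`, `b`, `c`:
the pulled-back hypergeometric equation is the Lamé equation. -/
def LameReducesTo (L : PeriodPair) (ℓ B : ℂ) (R : RatFunc ℂ) (a b c : ℂ) : Prop :=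
  (∀ k : ℂ, R ≠ RatFunc.C k) ∧
    ∀ u ∈ regularPoints L R,
      ((hypergeometricODE a b c).pullback (wpSubst L R)).p u = (lameODE L ℓ B).p u ∧
      ((hypergeometricODE a b c).pullback (wpSubst L R)).q u = (lameODE L ℓ B).q u

/-- The substitution `z = R(℘(u))` reduces the Lamé equation to some hypergeometric equation. -/
def IsLameReduction (L : PeriodPair) (ℓ B : ℂ) (R : RatFunc ℂ) : Prop :=
  ∃ a b c : ℂ, LameReducesTo L ℓ B R a b c

end

/-! ### Polynomial identities in `x = ℘(u)`. -/

section PolynomialIdentities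

open Polynomial

/-! Since `℘` has a pole at `0`, an identity in `℘(u)` near `0` is a polynomial identity in `x`,
with `℘' ^ 2 = P := 4 x ^ 3 - g₃` and `℘'' = 6 x ^ 2`. Write `R = N / D` in lowest terms. The
`ψ`-coefficient forces `D ^ 2` to divide `W ^ 2 * P`, `W` the Wronskian; as `P` is squarefree, `D`
is constant (`denom_eq_one_of_lameReducesTo`). Put `lam = ℓ (ℓ + 1)`, `d = a + b - c + 1`.
Eliminating `N''` between the two coefficient equations (`log_derivative_identity`) shows that, if
`c ≠ 1/2`, every root of `N` is `-B / lam`; so `N = k (x - r) ^ n`, and the first equation leaves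
only `r = 0`, `n = 3`, `k = 4 / g₃` (`eq_cube_of_first_identity`). If `c = 1/2`, then `d ≠ 1/2` and
the same applies to `1 - N`. The converse is direct computation. -/

lemma C_mul_X_add_C_ne_zero {lam : ℂ} (hlam : lam ≠ 0) (B : ℂ) :
    (C lam * X + C B : ℂ[X]) ≠ 0 := by
  intro h
  have := congrArg (fun p => coeff p 1) h
  simp [hlam] at this

/-- A double root would also be a root of `12 X ^ 2`, hence `0`, where the cubic is `-g ≠ 0`. -/
lemma not_sq_X_sub_C_dvd_cubic {g : ℂ} (hg : g ≠ 0) (r : ℂ) :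
    ¬ (X - C r) ^ 2 ∣ 4 * X ^ 3 - C g := by
  rintro ⟨Q, hQ⟩
  have h0 := congrArg (eval r) hQ
  have h1 := congrArg (fun p => eval r (derivative p)) hQ
  simp [derivative_pow] at h0 h1
  subst h1
  simp at h0
  exact hg h0

/-- If the derivative of the fraction `N / D` in lowest terms has `(N / D)' ^ 2 * (4 X ^ 3 - g)`
with denominator dividing `D ^ 2`, then the fraction is a polynomial. -/
lemma natDegree_eq_zero_of_sq_dvd_wronskian_sq {g : ℂ} (hg : g ≠ 0) {N D : ℂ[X]} (hD : D ≠ 0)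
    (hND : IsCoprime N D) (h : D ^ 2 ∣ wronskian N D ^ 2 * (4 * X ^ 3 - C g)) :
    D.natDegree = 0 := by
  by_contra hdeg
  obtain ⟨r, hr⟩ := IsAlgClosed.exists_root D
    (fun h => hdeg (natDegree_eq_zero_iff_degree_le_zero.2 h.le))
  obtain ⟨E, hE, hEr⟩ := exists_eq_pow_rootMultiplicity_mul_and_not_dvd D hD r
  obtain ⟨k, hk⟩ := Nat.exists_eq_add_one_of_ne_zero
    ((rootMultiplicity_pos hD).2 hr).ne'
  rw [hk] at hE
  have hNr : eval r N ≠ 0 := by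
    obtain ⟨a, b, hab⟩ := hND
    intro hN
    have := congrArg (eval r) hab
    simp [hN, hr.eq_zero] at this
  have hEr' : eval r E ≠ 0 := fun h => hEr (dvd_iff_isRoot.2 h)
  set V : ℂ[X] := N * (C (k + 1 : ℂ) * E + (X - C r) * derivative E)
    - derivative N * ((X - C r) * E) with hV
  -- A root of `D` of order `k + 1` is a root of the Wronskian of order exactly `k`, so the cubic
  -- would have to supply two more factors `X - C r`.
  have hW : wronskian N D = (X - C r) ^ k * V := by
    rw [wronskian, hE, hV]
    simp only [derivative_mul, derivative_pow, derivative_sub, derivative_X, derivative_C]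
    push_cast
    simp
    ring
  have hVr : ¬ (X - C r) ∣ V := by
    rw [dvd_iff_isRoot, IsRoot, hV]
    simp only [eval_sub, eval_mul, eval_add, eval_C, eval_X, sub_self, zero_mul, add_zero,
      mul_zero, sub_zero]
    exact mul_ne_zero hNr (mul_ne_zero (Nat.cast_add_one_ne_zero k) hEr')
  have hX : (X - C r : ℂ[X]) ^ k ≠ 0 := pow_ne_zero _ (X_sub_C_ne_zero r)
  have hdvd : (X - C r) ^ 2 ∣ V ^ 2 * (4 * X ^ 3 - C g) := by
    obtain ⟨A, hA⟩ := h
    refine ⟨E ^ 2 * A, mul_left_cancel₀ (pow_ne_zero 2 hX) ?_⟩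
    rw [hW, hE] at hA
    linear_combination hA
  have hcop : IsCoprime ((X - C r) ^ 2) (V ^ 2) :=
    (((irreducible_X_sub_C r).coprime_iff_not_dvd).2 hVr).pow
  exact not_sq_X_sub_C_dvd_cubic hg r (hcop.dvd_of_dvd_mul_left hdvd)

/-- Eliminating the second derivative of `N` between the equations for the two coefficients. -/
lemma log_derivative_identity {g lam B ab c d : ℂ} {N : ℂ[X]} (hN0 : N ≠ 0) (hN1 : N - 1 ≠ 0)
    (h1 : C ab * derivative N ^ 2 * (4 * X ^ 3 - C g) = -(C lam * X + C B) * (N * (N - 1)))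
    (h2 : N * (N - 1) * (derivative (derivative N) * (4 * X ^ 3 - C g) + 6 * X ^ 2 * derivative N)
      = (C c * (N - 1) + C d * N) * derivative N ^ 2 * (4 * X ^ 3 - C g)) :
    C lam * (N * (N - 1)) = (C lam * X + C B) * derivative N *
      (C (2 * c - 1) * (N - 1) + C (2 * d - 1) * N) := by
  have h3 := congrArg derivative h1
  simp only [derivative_mul, derivative_pow, derivative_sub, derivative_X, derivative_C,
    derivative_neg, derivative_add, derivative_ofNat, derivative_one] at h3
  apply mul_left_cancel₀ (mul_ne_zero hN0 hN1)
  simp only [C_sub, C_mul, C_ofNat, C_1] at h3 ⊢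
  push_cast at h3
  norm_num [C_ofNat] at h3
  -- `h2` removes the second derivative from the derivative of `h1`; `h1` itself then removes the
  -- cubic.
  linear_combination N * (N - 1) * h3 - 2 * C ab * derivative N * h2
    - 2 * derivative N * (C c * (N - 1) + C d * N) * h1

/-- At a root of order `k + 1` the left side vanishes to order `k + 1` but `N'` only to order `k`.
The last factor is `-c ≠ 0` there, so the linear factor must vanish. -/
lemma isRoot_of_log_derivative_identity {lam B c d : ℂ} {N : ℂ[X]} (hc : c ≠ 0) (hN0 : N ≠ 0)
    (h : C lam * (N * (N - 1)) = (C lam * X + C B) * derivative N * (C c * (N - 1) + C d * N))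
    {r : ℂ} (hr : N.IsRoot r) : lam * r + B = 0 := by
  obtain ⟨E, hE, hEr⟩ := exists_eq_pow_rootMultiplicity_mul_and_not_dvd N hN0 r
  obtain ⟨k, hk⟩ := Nat.exists_eq_add_one_of_ne_zero
    ((rootMultiplicity_pos hN0).2 hr).ne'
  rw [hk] at hE
  have hEr' : eval r E ≠ 0 := fun h => hEr (dvd_iff_isRoot.2 h)
  have hX : (X - C r : ℂ[X]) ^ k ≠ 0 := pow_ne_zero _ (X_sub_C_ne_zero r)
  have hN' : derivative N = (X - C r) ^ k * (C (k + 1 : ℂ) * E + (X - C r) * derivative E) := by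
    rw [hE]
    simp only [derivative_mul, derivative_pow, derivative_sub, derivative_X, derivative_C]
    push_cast
    simp
    ring
  have h' : C lam * ((X - C r) * E * (N - 1)) = (C lam * X + C B) *
      (C (k + 1 : ℂ) * E + (X - C r) * derivative E) * (C c * (N - 1) + C d * N) := by
    apply mul_left_cancel₀ hX
    rw [hN'] at h
    linear_combination h - C lam * (N - 1) * hE
  have h0 := congrArg (eval r) h'
  simp only [eval_mul, eval_add, eval_sub, eval_C, eval_X, eval_one, hr.eq_zero, sub_self,
    zero_mul, mul_zero, add_zero, zero_sub] at h0
  have hk1 : (k + 1 : ℂ) ≠ 0 := Nat.cast_add_one_ne_zero k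
  simpa [hk1, hEr', hc] using h0.symm

lemma eq_C_mul_X_sub_C_pow {N : ℂ[X]} {r : ℂ} (h : ∀ s, N.IsRoot s → s = r) :
    N = C N.leadingCoeff * (X - C r) ^ N.natDegree := by
  have hs := IsAlgClosed.splits N
  have hroots : N.roots = Multiset.replicate N.natDegree r :=
    Multiset.eq_replicate.2 ⟨hs.natDegree_eq_card_roots.symm,
      fun s hs => h s (isRoot_of_mem_roots hs)⟩
  conv_lhs => rw [hs.eq_prod_roots, hroots]
  simp

/-- After cancelling powers of `X - C r`: `n = 1` gives the cubic a double root, `n = 2` fails at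
`0`, and `n ≥ 4` fails at `r`. -/
lemma eq_cube_of_first_identity {g lam ab r k : ℂ} {n : ℕ} (hg : g ≠ 0) (hlam : lam ≠ 0)
    (hab : ab ≠ 0) (hk : k ≠ 0) (hn : n ≠ 0)
    (h : C ab * derivative (C k * (X - C r) ^ n) ^ 2 * (4 * X ^ 3 - C g) =
      -(C lam * (X - C r)) * ((C k * (X - C r) ^ n) * (C k * (X - C r) ^ n - 1))) :
    r = 0 ∧ n = 3 ∧ k = 4 / g := by
  have hX : (X - C r : ℂ[X]) ≠ 0 := X_sub_C_ne_zero r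
  have hCk : (C k : ℂ[X]) ≠ 0 := C_ne_zero.2 hk
  obtain ⟨m, rfl⟩ := Nat.exists_eq_add_one_of_ne_zero hn
  have hd : derivative (C k * (X - C r) ^ (m + 1)) = C k * (C (m + 1 : ℂ) * (X - C r) ^ m) := by
    simp [derivative_X_sub_C_pow]
  rw [hd] at h
  rcases m with _ | _ | _ | m
  · exfalso
    refine not_sq_X_sub_C_dvd_cubic hg r ?_
    have : C (ab * k) * (4 * X ^ 3 - C g) =
        (X - C r) ^ 2 * (-C lam * (C k * (X - C r) - 1)) := by
      apply mul_left_cancel₀ hCk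
      simp only [C_mul]
      simp at h
      linear_combination h
    have hu : IsUnit (C (ab * k) : ℂ[X]) := isUnit_C.2 (mul_ne_zero hab hk).isUnit
    exact hu.dvd_mul_left.1 ⟨_, this⟩
  · exfalso
    have h' : C (4 * ab * k) * (4 * X ^ 3 - C g) =
        -(C lam * (X - C r)) * (C k * (X - C r) ^ 2 - 1) := by
      apply mul_left_cancel₀ (mul_ne_zero hCk (pow_ne_zero 2 hX))
      simp only [C_mul, C_ofNat]
      norm_num [C_ofNat] at h
      linear_combination h
    have e (x : ℂ) := congrArg (eval x) h'
    simp at e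
    -- The second difference at `1, 0, -1` isolates the coefficient of `X ^ 2`, absent from `4 X ^ 3
    -- - g`.
    have hr : lam * k * r = 0 := by
      linear_combination -(1 / 6) * (e 1 + e (-1) - 2 * e 0)
    have hr : r = 0 := by simpa [hlam, hk] using hr
    have e0 := e 0
    simp [hr, hab, hk, hg] at e0
  · have h' : C (9 * ab * k) * (4 * X ^ 3 - C g) = -(C lam) * (C k * (X - C r) ^ 3 - 1) := by
      apply mul_left_cancel₀ (mul_ne_zero hCk (pow_ne_zero 4 hX))
      simp only [C_mul, C_ofNat]
      norm_num [C_ofNat] at h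
      linear_combination h
    have e (x : ℂ) := congrArg (eval x) h'
    simp at e
    have hr : lam * k * r = 0 := by
      linear_combination -(1 / 6) * (e 1 + e (-1) - 2 * e 0)
    have hr : r = 0 := by simpa [hlam, hk] using hr
    have e0 := e 0
    have e1 := e 1
    simp [hr] at e0 e1
    refine ⟨hr, rfl, ?_⟩
    rw [eq_div_iff hg]
    apply mul_left_cancel₀ (mul_ne_zero hab hk)
    linear_combination (1 / 9) * (e0 - k * e0 - e1)
  · exfalso
    have h' : C (ab * k * (m + 4) ^ 2) * (X - C r) ^ (m + 1) * (4 * X ^ 3 - C g) =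
        -(C lam) * (C k * (X - C r) ^ (m + 4) - 1) := by
      apply mul_left_cancel₀ (mul_ne_zero hCk (pow_ne_zero (m + 5) hX))
      push_cast at h
      simp only [C_mul, C_pow, C_add, C_1, C_ofNat] at h ⊢
      linear_combination h
    have := congrArg (eval r) h'
    simp at this
    exact hlam this.symm

/-- The polynomials that solve the equations for both coefficients. -/
lemma eq_cube_of_identities {g lam B ab c d : ℂ} {N : ℂ[X]} (hg : g ≠ 0) (hlam : lam ≠ 0)
    (hN : N.natDegree ≠ 0) (hc : 2 * c - 1 ≠ 0)
    (h1 : C ab * derivative N ^ 2 * (4 * X ^ 3 - C g) = -(C lam * X + C B) * (N * (N - 1)))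
    (h2 : N * (N - 1) * (derivative (derivative N) * (4 * X ^ 3 - C g) + 6 * X ^ 2 * derivative N)
      = (C c * (N - 1) + C d * N) * derivative N ^ 2 * (4 * X ^ 3 - C g)) :
    B = 0 ∧ N = C (4 / g) * X ^ 3 := by
  have hN0 : N ≠ 0 := by rintro rfl; simp at hN
  have hN1 : N - 1 ≠ 0 := fun h => hN (by rw [sub_eq_zero.1 h]; simp)
  have hab : ab ≠ 0 := by
    rintro rfl
    rw [C_0, zero_mul, zero_mul] at h1
    exact mul_ne_zero (neg_ne_zero.2 (C_mul_X_add_C_ne_zero hlam B)) (mul_ne_zero hN0 hN1)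
      h1.symm
  have h3 := log_derivative_identity hN0 hN1 h1 h2
  have hroot (s : ℂ) (hs : N.IsRoot s) : s = -B / lam := by
    have := isRoot_of_log_derivative_identity hc hN0 h3 hs
    field_simp
    linear_combination this
  have hpow := eq_C_mul_X_sub_C_pow hroot
  have hlin : (C lam * X + C B : ℂ[X]) = C lam * (X - C (-B / lam)) := by
    rw [mul_sub, ← C_mul, mul_div_cancel₀ _ hlam]
    simp
  rw [hlin, hpow] at h1
  obtain ⟨hr, hn, hk⟩ := eq_cube_of_first_identity hg hlam hab
    (leadingCoeff_ne_zero.2 hN0) hN h1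
  refine ⟨by simpa [hlam] using hr, ?_⟩
  rw [hpow, hr, hn, hk]
  simp

lemma eq_cube_or_one_sub_cube_of_identities {g lam B ab c d : ℂ} {N : ℂ[X]} (hg : g ≠ 0)
    (hlam : lam ≠ 0) (hN : N.natDegree ≠ 0)
    (h1 : C ab * derivative N ^ 2 * (4 * X ^ 3 - C g) = -(C lam * X + C B) * (N * (N - 1)))
    (h2 : N * (N - 1) * (derivative (derivative N) * (4 * X ^ 3 - C g) + 6 * X ^ 2 * derivative N)
      = (C c * (N - 1) + C d * N) * derivative N ^ 2 * (4 * X ^ 3 - C g)) :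
    B = 0 ∧ (N = C (4 / g) * X ^ 3 ∨ N = 1 - C (4 / g) * X ^ 3) := by
  by_cases hc : 2 * c - 1 = 0
  · by_cases hd : 2 * d - 1 = 0
    · exfalso
      have hN0 : N ≠ 0 := by rintro rfl; simp at hN
      have hN1 : N - 1 ≠ 0 := fun h => hN (by rw [sub_eq_zero.1 h]; simp)
      have h3 := log_derivative_identity hN0 hN1 h1 h2
      simp [hc, hd, hlam, hN0, hN1] at h3
    -- The symmetry `z ↦ 1 - z` exchanges `c` and `d`.
    · obtain ⟨hB, h⟩ := eq_cube_of_identities (N := 1 - N) (B := B) (ab := ab) (c := d) (d := c)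
        hg hlam (by rwa [natDegree_sub, ← C_1, natDegree_sub_C]) hd
        (by simp; linear_combination h1) (by simp; linear_combination -h2)
      exact ⟨hB, Or.inr (by rw [← h]; ring)⟩
  · obtain ⟨hB, h⟩ := eq_cube_of_identities hg hlam hN hc h1 h2
    exact ⟨hB, Or.inl h⟩

end PolynomialIdentities

/-! ### The Weierstrass function near its pole and its differential equations. -/

section WeierstrassFunction

open Polynomial

namespace PeriodPair

variable (L : PeriodPair)

lemma tendsto_weierstrassP_zero_cobounded :
    Filter.Tendsto L.weierstrassP (𝓝[≠] 0) (Bornology.cobounded ℂ) := by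
  rw [tendsto_cobounded_iff_meromorphicOrderAt_neg (L.meromorphic_weierstrassP 0),
    L.order_weierstrassP 0 (zero_mem _)]
  decide

/-- Near its pole `℘` leaves the finite, hence bounded, root set of `Q`. -/
lemma eventually_eval_weierstrassP_ne_zero {Q : ℂ[X]} (hQ : Q ≠ 0) :
    ∀ᶠ u in 𝓝[≠] (0 : ℂ), Q.eval (L.weierstrassP u) ≠ 0 := by
  have hfin : {x | Q.IsRoot x}.Finite := finite_setOfPred_isRoot hQ
  have := L.tendsto_weierstrassP_zero_cobounded.eventually
    (Bornology.isBounded_def.1 hfin.isBounded)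
  filter_upwards [this] with u hu using hu

lemma eq_zero_of_eventually_eval_weierstrassP {Q : ℂ[X]}
    (h : ∀ᶠ u in 𝓝[≠] (0 : ℂ), Q.eval (L.weierstrassP u) = 0) : Q = 0 := by
  by_contra hQ
  obtain ⟨u, h0, h1⟩ := (h.and (L.eventually_eval_weierstrassP_ne_zero hQ)).exists
  exact h1 h0

lemma eventually_notMem_lattice : ∀ᶠ u in 𝓝[≠] (0 : ℂ), u ∉ L.lattice := by
  have := L.compl_lattice_sdiff_singleton_mem_nhds 0
  filter_upwards [nhdsWithin_le_nhds this, self_mem_nhdsWithin] with u hu h0 hl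
  exact hu ⟨hl, h0⟩

variable {L} {u : ℂ}

lemma hasDerivAt_weierstrassP (hu : u ∉ L.lattice) :
    HasDerivAt L.weierstrassP (L.derivWeierstrassP u) u := by
  have := (L.analyticOnNhd_weierstrassP u hu).differentiableAt.hasDerivAt
  rwa [L.deriv_weierstrassP] at this

lemma isOpen_compl_lattice : IsOpen (L.lattice : Set ℂ)ᶜ := L.isClosed_lattice.isOpen_compl

/-- `℘'' = 6 ℘ ^ 2` if `g₂ = 0`. -/
lemma hasDerivAt_derivWeierstrassP (hg₂ : L.g₂ = 0) (hu : u ∉ L.lattice)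
    (h0 : L.derivWeierstrassP u ≠ 0) :
    HasDerivAt L.derivWeierstrassP (6 * L.weierstrassP u ^ 2) u := by
  have hd := (L.analyticOnNhd_derivWeierstrassP u hu).differentiableAt.hasDerivAt
  have h1 : HasDerivAt (fun u => 4 * L.weierstrassP u ^ 3 - L.g₃) _ u :=
    (((hasDerivAt_weierstrassP hu).pow 3).const_mul 4).sub_const _
  have h2 : (fun u => L.derivWeierstrassP u ^ 2) =ᶠ[𝓝 u]
      fun u => 4 * L.weierstrassP u ^ 3 - L.g₃ := by
    filter_upwards [isOpen_compl_lattice.mem_nhds hu] with v hv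
    rw [L.derivWeierstrassP_sq v hv, hg₂]
    ring
  -- Differentiates `℘' ^ 2 = 4 ℘ ^ 3 - g₃`; `h0` then allows division by `2 ℘'`.
  have h3 := (hd.pow 2).unique (h1.congr_of_eventuallyEq h2)
  convert! hd using 1
  apply mul_left_cancel₀ h0
  simp at h3
  linear_combination -(1 / 2) * h3

lemma hasDerivAt_eval_weierstrassP (N : ℂ[X]) (hu : u ∉ L.lattice) :
    HasDerivAt (fun u => N.eval (L.weierstrassP u))
      (N.derivative.eval (L.weierstrassP u) * L.derivWeierstrassP u) u :=
  (N.hasDerivAt _).comp u (hasDerivAt_weierstrassP hu)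

lemma deriv_deriv_eval_weierstrassP (N : ℂ[X]) (hg₂ : L.g₂ = 0) (hu : u ∉ L.lattice)
    (h0 : L.derivWeierstrassP u ≠ 0) :
    deriv (deriv fun u => N.eval (L.weierstrassP u)) u =
      N.derivative.derivative.eval (L.weierstrassP u) * L.derivWeierstrassP u ^ 2 +
      N.derivative.eval (L.weierstrassP u) * (6 * L.weierstrassP u ^ 2) := by
  have h1 : deriv (fun u => N.eval (L.weierstrassP u)) =ᶠ[𝓝 u]
      fun u => N.derivative.eval (L.weierstrassP u) * L.derivWeierstrassP u := by
    filter_upwards [isOpen_compl_lattice.mem_nhds hu] with v hv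
    exact (hasDerivAt_eval_weierstrassP N hv).deriv
  rw [h1.deriv_eq, ((hasDerivAt_eval_weierstrassP N.derivative hu).fun_mul
    (hasDerivAt_derivWeierstrassP hg₂ hu h0)).deriv]
  ring

end PeriodPair

end WeierstrassFunction

/-! ### From substitutions to polynomial identities and back. -/

section Substitution

open Polynomial

variable {L : PeriodPair} {u : ℂ}

lemma wpSubst_eq (R : RatFunc ℂ) :
    wpSubst L R = fun u => R.num.eval (L.weierstrassP u) / R.denom.eval (L.weierstrassP u) :=
  rfl

lemma wpSubst_algebraMap (N : ℂ[X]) :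
    wpSubst L (algebraMap ℂ[X] (RatFunc ℂ) N) = fun u => N.eval (L.weierstrassP u) := by
  simp [wpSubst_eq]

lemma deriv_wpSubst (R : RatFunc ℂ) (hu : u ∉ L.lattice)
    (hD : R.denom.eval (L.weierstrassP u) ≠ 0) :
    deriv (wpSubst L R) u = -(wronskian R.num R.denom).eval (L.weierstrassP u) *
      L.derivWeierstrassP u / R.denom.eval (L.weierstrassP u) ^ 2 := by
  rw [wpSubst_eq, ((PeriodPair.hasDerivAt_eval_weierstrassP R.num hu).fun_div
    (PeriodPair.hasDerivAt_eval_weierstrassP R.denom hu) hD).deriv]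
  simp only [wronskian, eval_sub, eval_mul]
  ring

lemma wronskian_num_denom_ne_zero {R : RatFunc ℂ} (hR : ∀ k : ℂ, R ≠ RatFunc.C k) :
    wronskian R.num R.denom ≠ 0 := by
  rw [Ne, R.isCoprime_num_denom.wronskian_eq_zero_iff]
  rintro ⟨hn, hd⟩
  have hn' := eq_C_of_natDegree_eq_zero (derivative_eq_zero.1 hn)
  have hd' := eq_one_of_monic_natDegree_zero R.monic_denom
    (derivative_eq_zero.1 hd)
  apply hR (R.num.coeff 0)
  conv_lhs => rw [← R.num_div_denom, hd', hn']
  simp [RatFunc.algebraMap_C]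

lemma num_ne_zero_of_forall_ne_C {R : RatFunc ℂ} (hR : ∀ k : ℂ, R ≠ RatFunc.C k) :
    R.num ≠ 0 := by
  rw [Ne, RatFunc.num_eq_zero_iff]
  simpa using hR 0

lemma num_sub_denom_ne_zero_of_forall_ne_C {R : RatFunc ℂ} (hR : ∀ k : ℂ, R ≠ RatFunc.C k) :
    R.num - R.denom ≠ 0 := by
  intro h
  apply hR 1
  rw [← R.num_div_denom, sub_eq_zero.1 h, div_self, map_one]
  simpa using R.denom_ne_zero

/-- Off the lattice, regularity amounts to a few nonzero polynomials not vanishing at `℘(u)`; for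
`℘'` use its square. -/
lemma eventually_mem_regularPoints (hg₂ : L.g₂ = 0) {R : RatFunc ℂ}
    (hR : ∀ k : ℂ, R ≠ RatFunc.C k) :
    ∀ᶠ u in 𝓝[≠] (0 : ℂ), u ∈ regularPoints L R := by
  have hP : (4 * X ^ 3 - C L.g₃ : ℂ[X]) ≠ 0 := by
    intro h
    have := congrArg (fun p => coeff p 3) h
    simp at this
  have hN := num_ne_zero_of_forall_ne_C hR
  have hND := num_sub_denom_ne_zero_of_forall_ne_C hR
  filter_upwards [L.eventually_notMem_lattice,
    L.eventually_eval_weierstrassP_ne_zero R.denom_ne_zero,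
    L.eventually_eval_weierstrassP_ne_zero hN, L.eventually_eval_weierstrassP_ne_zero hND,
    L.eventually_eval_weierstrassP_ne_zero (wronskian_num_denom_ne_zero hR),
    L.eventually_eval_weierstrassP_ne_zero hP] with u hu hD hN hND hW hP
  have hsq := L.derivWeierstrassP_sq u hu
  have h0 : L.derivWeierstrassP u ≠ 0 := by
    intro h
    simp [h, hg₂] at hsq hP
    exact hP hsq.symm
  refine ⟨hu, hD, div_ne_zero hN hD, ?_, ?_⟩
  · rw [wpSubst_eq]
    simpa [div_eq_one_iff_eq hD, sub_eq_zero] using hND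
  · rw [deriv_wpSubst R hu hD]
    exact div_ne_zero (mul_ne_zero (neg_ne_zero.2 hW) h0) (pow_ne_zero 2 hD)

variable {ℓ B a b c : ℂ}

/-- The equation for the coefficient of the unknown function, in terms of `x = ℘(u)`. -/
lemma wronskian_identity_of_lameReducesTo (hg₂ : L.g₂ = 0) {R : RatFunc ℂ}
    (h : LameReducesTo L ℓ B R a b c) :
    C (a * b) * (wronskian R.num R.denom ^ 2 * (4 * X ^ 3 - C L.g₃)) =
      -(C (ℓ * (ℓ + 1)) * X + C B) * (R.num * (R.num - R.denom)) * R.denom ^ 2 := by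
  rw [← sub_eq_zero]
  apply L.eq_zero_of_eventually_eval_weierstrassP
  filter_upwards [eventually_mem_regularPoints hg₂ h.1] with u hu
  have hq := (h.2 u hu).2
  obtain ⟨hu, hD, h0, h1, -⟩ := hu
  have hsq := L.derivWeierstrassP_sq u hu
  simp only [LinearODE.pullback, hypergeometricODE, lameODE, deriv_wpSubst R hu hD] at hq
  have h1' := sub_ne_zero.2 h1
  have hφ : wpSubst L R u * R.denom.eval (L.weierstrassP u) = R.num.eval (L.weierstrassP u) :=
    div_mul_cancel₀ _ hD
  simp only [eval_add, eval_mul, eval_pow, eval_sub, eval_neg, eval_C, eval_X, eval_ofNat]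
  rw [← hφ]
  rw [hg₂] at hsq
  generalize wpSubst L R u = φ at *
  field_simp at hq
  linear_combination hq - a * b * (wronskian R.num R.denom).eval (L.weierstrassP u) ^ 2 * hsq

lemma denom_eq_one_of_lameReducesTo (hg₂ : L.g₂ = 0) (hg₃ : L.g₃ ≠ 0) (hℓ : ℓ * (ℓ + 1) ≠ 0)
    {R : RatFunc ℂ} (h : LameReducesTo L ℓ B R a b c) : R.denom = 1 := by
  have hpoly := wronskian_identity_of_lameReducesTo hg₂ h
  refine eq_one_of_monic_natDegree_zero R.monic_denom
    (natDegree_eq_zero_of_sq_dvd_wronskian_sq hg₃ R.denom_ne_zero R.isCoprime_num_denom ?_)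
  have hab : a * b ≠ 0 := by
    intro hab
    rw [hab, C_0, zero_mul] at hpoly
    exact mul_ne_zero (mul_ne_zero (neg_ne_zero.2 (C_mul_X_add_C_ne_zero hℓ B))
      (mul_ne_zero (num_ne_zero_of_forall_ne_C h.1) (num_sub_denom_ne_zero_of_forall_ne_C h.1)))
      (pow_ne_zero 2 R.denom_ne_zero) hpoly.symm
  have hu : IsUnit (C (a * b) : ℂ[X]) := isUnit_C.2 hab.isUnit
  exact hu.dvd_mul_left.1 ⟨_, hpoly.trans (mul_comm _ _)⟩

/-- The equation for the coefficient of the first derivative, in terms of `x = ℘(u)`. -/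
lemma second_order_identity_of_lameReducesTo (hg₂ : L.g₂ = 0) {N : ℂ[X]}
    (h : LameReducesTo L ℓ B (algebraMap ℂ[X] (RatFunc ℂ) N) a b c) :
    N * (N - 1) * (derivative (derivative N) * (4 * X ^ 3 - C L.g₃) + 6 * X ^ 2 * derivative N)
      = (C c * (N - 1) + C (a + b - c + 1) * N) * derivative N ^ 2 * (4 * X ^ 3 - C L.g₃) := by
  rw [← sub_eq_zero]
  apply L.eq_zero_of_eventually_eval_weierstrassP
  filter_upwards [eventually_mem_regularPoints hg₂ h.1] with u hu
  have hp := (h.2 u hu).1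
  obtain ⟨hu, -, h0, h1, h'⟩ := hu
  have hsq := L.derivWeierstrassP_sq u hu
  rw [wpSubst_algebraMap] at hp h0 h1 h'
  have hd := (PeriodPair.hasDerivAt_eval_weierstrassP N hu).deriv
  rw [hd] at h'
  simp only [LinearODE.pullback, hypergeometricODE, lameODE, hd,
    PeriodPair.deriv_deriv_eval_weierstrassP N hg₂ hu (right_ne_zero_of_mul h')] at hp
  have h1' := sub_ne_zero.2 h1
  simp only [eval_add, eval_mul, eval_pow, eval_sub, eval_C, eval_X, eval_ofNat, eval_one]
  rw [hg₂] at hsq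
  have h'1 := left_ne_zero_of_mul h'
  have h'2 := right_ne_zero_of_mul h'
  field_simp at hp
  generalize L.weierstrassP u = x at *
  linear_combination -hp + ((c * (N.eval x - 1) + N.eval x * (a + b - c + 1)) *
    (derivative N).eval x ^ 2 - N.eval x * (N.eval x - 1) * N.derivative.derivative.eval x) * hsq

lemma eq_cube_or_one_sub_cube_of_lameReducesTo (hg₂ : L.g₂ = 0) (hg₃ : L.g₃ ≠ 0)
    (hℓ : ℓ * (ℓ + 1) ≠ 0) {R : RatFunc ℂ} (h : LameReducesTo L ℓ B R a b c) :
    B = 0 ∧ (R = RatFunc.C (4 / L.g₃) * RatFunc.X ^ 3 ∨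
      R = 1 - RatFunc.C (4 / L.g₃) * RatFunc.X ^ 3) := by
  have hD := denom_eq_one_of_lameReducesTo hg₂ hg₃ hℓ h
  have hR : algebraMap ℂ[X] (RatFunc ℂ) R.num = R := by simpa [hD] using R.num_div_denom
  have h1 := wronskian_identity_of_lameReducesTo hg₂ h
  have h2 := second_order_identity_of_lameReducesTo hg₂ (hR.symm ▸ h)
  have hN : R.num.natDegree ≠ 0 := by
    intro h0
    apply h.1 (R.num.coeff 0)
    rw [← hR, eq_C_of_natDegree_eq_zero h0]
    simp [RatFunc.algebraMap_C]
  have hW : wronskian R.num 1 = -derivative R.num := by simp [wronskian]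
  rw [hD, hW] at h1
  obtain ⟨hB, h⟩ := eq_cube_or_one_sub_cube_of_identities (ab := a * b) (B := B) hg₃ hℓ hN
    (by linear_combination h1) h2
  refine ⟨hB, h.imp (fun h => ?_) (fun h => ?_)⟩ <;>
  · rw [← hR, h]
    simp [RatFunc.algebraMap_C, RatFunc.algebraMap_X]

lemma C_mul_X_pow_three_ne_C {k : ℂ} (hk : k ≠ 0) (m : ℂ) :
    RatFunc.C k * RatFunc.X ^ 3 ≠ RatFunc.C m := by
  intro h
  have h' : algebraMap ℂ[X] (RatFunc ℂ) (C k * X ^ 3) = algebraMap ℂ[X] (RatFunc ℂ) (C m) := by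
    simpa [RatFunc.algebraMap_C, RatFunc.algebraMap_X] using h
  have := congrArg (fun p => coeff p 3) (RatFunc.algebraMap_injective ℂ h')
  simp [hk] at this

/-- A polynomial substitution reduces the Lamé equation if both coefficients agree at all points
where they are defined. -/
lemma lameReducesTo_algebraMap (hg₂ : L.g₂ = 0) {N : ℂ[X]}
    (hN : ∀ k : ℂ, algebraMap ℂ[X] (RatFunc ℂ) N ≠ RatFunc.C k)
    (h : ∀ x y : ℂ, y ^ 2 = 4 * x ^ 3 - L.g₃ → y ≠ 0 → N.eval x ≠ 0 → N.eval x - 1 ≠ 0 →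
      N.derivative.eval x ≠ 0 →
      (c / N.eval x + (a + b - c + 1) / (N.eval x - 1)) * (N.derivative.eval x * y) -
        (N.derivative.derivative.eval x * y ^ 2 + N.derivative.eval x * (6 * x ^ 2)) /
          (N.derivative.eval x * y) = 0 ∧
      a * b / (N.eval x * (N.eval x - 1)) * (N.derivative.eval x * y) ^ 2 =
        -(ℓ * (ℓ + 1) * x + B)) :
    LameReducesTo L ℓ B (algebraMap ℂ[X] (RatFunc ℂ) N) a b c := by
  refine ⟨hN, fun u ⟨hu, _, h0, h1, h'⟩ => ?_⟩
  have hd := (PeriodPair.hasDerivAt_eval_weierstrassP N hu).deriv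
  simp only [wpSubst_algebraMap] at h0 h1 h' ⊢
  rw [hd] at h'
  have hy := right_ne_zero_of_mul h'
  simp only [LinearODE.pullback, hypergeometricODE, lameODE, hd,
    PeriodPair.deriv_deriv_eval_weierstrassP N hg₂ hu hy]
  refine h _ _ ?_ hy h0 (sub_ne_zero.2 h1) (left_ne_zero_of_mul h')
  rw [L.derivWeierstrassP_sq u hu, hg₂]
  ring

lemma lameReducesTo_cube (hg₂ : L.g₂ = 0) (hg₃ : L.g₃ ≠ 0) :
    LameReducesTo L ℓ 0 (RatFunc.C (4 / L.g₃) * RatFunc.X ^ 3)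
      -- Here `a + b = 1/6`, so `2/3 = a + b - 1/2 + 1` is the partner of `c = 1/2` under `z ↦ 1 -
      -- z`.
      (-ℓ / 6) ((ℓ + 1) / 6) (2 / 3) := by
  have hR : RatFunc.C (4 / L.g₃) * RatFunc.X ^ 3 =
      algebraMap ℂ[X] (RatFunc ℂ) (C (4 / L.g₃) * X ^ 3) := by
    simp [RatFunc.algebraMap_C, RatFunc.algebraMap_X]
  have hk : 4 / L.g₃ ≠ 0 := div_ne_zero (by norm_num) hg₃
  rw [hR]
  refine lameReducesTo_algebraMap hg₂ (fun k => hR ▸ C_mul_X_pow_three_ne_C hk k) ?_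
  intro x y hxy hy h0 h1 h'
  simp at h0 h1 h' ⊢
  have hx : x ≠ 0 := by rintro rfl; simp at h0
  -- On the curve, `z - 1` is a multiple of `℘' ^ 2`, which cancels.
  have h1' : 4 / L.g₃ * x ^ 3 - 1 = y ^ 2 / L.g₃ := by
    rw [hxy]
    field_simp
  rw [h1']
  constructor
  · field_simp
    ring
  · field_simp
    ring

lemma lameReducesTo_one_sub_cube (hg₂ : L.g₂ = 0) (hg₃ : L.g₃ ≠ 0) :
    LameReducesTo L ℓ 0 (1 - RatFunc.C (4 / L.g₃) * RatFunc.X ^ 3)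
      (-ℓ / 6) ((ℓ + 1) / 6) (1 / 2) := by
  have hR : 1 - RatFunc.C (4 / L.g₃) * RatFunc.X ^ 3 =
      algebraMap ℂ[X] (RatFunc ℂ) (1 - C (4 / L.g₃) * X ^ 3) := by
    simp [RatFunc.algebraMap_C, RatFunc.algebraMap_X]
  have hk : 4 / L.g₃ ≠ 0 := div_ne_zero (by norm_num) hg₃
  rw [hR]
  refine lameReducesTo_algebraMap hg₂ (fun k h => ?_) ?_
  · rw [← hR, sub_eq_iff_eq_add, ← sub_eq_iff_eq_add'] at h
    exact C_mul_X_pow_three_ne_C hk (1 - k) (by rw [← h]; simp)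
  intro x y hxy hy h0 h1 h'
  simp at h0 h1 h' ⊢
  have hx : x ≠ 0 := by rintro rfl; simp at h1
  have h1' : 1 - 4 / L.g₃ * x ^ 3 = -(y ^ 2 / L.g₃) := by
    rw [hxy]
    field_simp
    ring
  rw [h1']
  constructor
  · field_simp
    ring
  · field_simp
    ring

/-- The change of variables `τ = (4 / ρ ^ 2) ℘` of Clarkson and Olver. -/
lemma exists_clarkson_olver_variable (hg₂ : L.g₂ = 0) (hg₃ : L.g₃ ≠ 0) {ρ : ℂ}
    (hρ : ρ ^ 6 = 16 * L.g₃) :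
    ∃ τ : ℂ → ℂ, DifferentiableOn ℂ τ (L.lattice : Set ℂ)ᶜ ∧
      Filter.Tendsto τ (𝓝[≠] 0) (Bornology.cobounded ℂ) ∧
      ∀ u ∉ L.lattice,
        τ u ^ 3 = 4 * L.weierstrassP u ^ 3 / L.g₃ ∧
        (Complex.I / ρ * deriv τ u) ^ 2 = 1 - τ u ^ 3 := by
  have hρ0 : ρ ≠ 0 := by
    rintro rfl
    simp [hg₃] at hρ
  have hk : 4 / ρ ^ 2 ≠ 0 := div_ne_zero (by norm_num) (pow_ne_zero 2 hρ0)
  -- `(4 / ρ ^ 2) ^ 3 = 64 / ρ ^ 6 = 4 / g₃`; likewise `(i / ρ) ^ 2 (4 / ρ ^ 2) ^ 2 = -1 / g₃`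
  -- below.
  have hcube (u : ℂ) :
      (4 / ρ ^ 2 * L.weierstrassP u) ^ 3 = 4 * L.weierstrassP u ^ 3 / L.g₃ := by
    field_simp
    linear_combination -L.weierstrassP u ^ 3 * hρ
  refine ⟨fun u => 4 / ρ ^ 2 * L.weierstrassP u,
    L.differentiableOn_weierstrassP.const_mul _,
    (Filter.tendsto_mul_left_cobounded hk).comp L.tendsto_weierstrassP_zero_cobounded,
    fun u hu => ⟨hcube u, ?_⟩⟩
  rw [((PeriodPair.hasDerivAt_weierstrassP hu).const_mul _).deriv, hcube]
  have hsq := L.derivWeierstrassP_sq u hu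
  rw [hg₂] at hsq
  simp only [mul_pow, div_pow, Complex.I_sq, hsq]
  field_simp
  linear_combination (4 * L.weierstrassP u ^ 3 - L.g₃) * hρ

end Substitution

theorem mainTheorem10 (L : PeriodPair) (hg₂ : L.g₂ = 0) (hg₃ : L.g₃ ≠ 0)
    (ℓ B : ℂ) (hℓ : ℓ * (ℓ + 1) ≠ 0) :
    -- a reduction exists iff `B = 0`
    ((∃ R : RatFunc ℂ, IsLameReduction L ℓ B R) ↔ B = 0) ∧
    (B = 0 →
      -- the reductions are exactly `z = 4 ℘ ^ 3 / g₃` and `z = 1 - 4 ℘ ^ 3 / g₃`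
      (∀ R : RatFunc ℂ, IsLameReduction L ℓ B R ↔
        R = RatFunc.C (4 / L.g₃) * RatFunc.X ^ 3 ∨
        R = 1 - RatFunc.C (4 / L.g₃) * RatFunc.X ^ 3) ∧
      -- the second one yields the hypergeometric equation of Clarkson and Olver
      LameReducesTo L ℓ B (1 - RatFunc.C (4 / L.g₃) * RatFunc.X ^ 3)
        (-ℓ / 6) ((ℓ + 1) / 6) (1 / 2)) ∧
    -- and it is their change of variables: with `ρ = (16 g₃) ^ (1/6)`, a branch `τ` of
    -- `(1 - z) ^ (1/3)` satisfies `du = (i / ρ) dτ / √(1 - τ ^ 3)`, with `τ = ∞` at `u = 0`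
    (∀ ρ : ℂ, ρ ^ 6 = 16 * L.g₃ →
      ∃ τ : ℂ → ℂ, DifferentiableOn ℂ τ (L.lattice : Set ℂ)ᶜ ∧
        Filter.Tendsto τ (𝓝[≠] 0) (Bornology.cobounded ℂ) ∧
        ∀ u ∉ L.lattice,
          τ u ^ 3 = 1 - (1 - 4 * L.weierstrassP u ^ 3 / L.g₃) ∧
          (Complex.I / ρ * deriv τ u) ^ 2 = 1 - τ u ^ 3) := by
  refine ⟨⟨fun ⟨R, a, b, c, h⟩ => (eq_cube_or_one_sub_cube_of_lameReducesTo hg₂ hg₃ hℓ h).1, ?_⟩,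
    ?_, ?_⟩
  · rintro rfl
    exact ⟨_, _, _, _, lameReducesTo_cube hg₂ hg₃⟩
  · rintro rfl
    refine ⟨fun R => ⟨fun ⟨a, b, c, h⟩ =>
      (eq_cube_or_one_sub_cube_of_lameReducesTo hg₂ hg₃ hℓ h).2, ?_⟩,
      lameReducesTo_one_sub_cube hg₂ hg₃⟩
    rintro (rfl | rfl)
    · exact ⟨_, _, _, lameReducesTo_cube hg₂ hg₃⟩
    · exact ⟨_, _, _, lameReducesTo_one_sub_cube hg₂ hg₃⟩
  · intro ρ hρ
    simpa only [sub_sub_cancel] using exists_clarkson_olver_variable hg₂ hg₃ hρ
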